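/- For a partition $\lambda$ of $n\ge 0$, let $\lambda'$ denote its conjugate, that is, the partition of $n$ whose $i$-th part is the number of parts of $\lambda$ that are at least $i$, and let $\mathcal{O}(\lambda)$ be the number of odd parts of $\lambda$, counted with multiplicity. Let $p(n)$ be the number of partitions of $n$, let $t(n)$ be the number of partitions $\lambda$ of $n$ with $\mathcal{O}(\lambda)\equiv\mathcal{O}(\lambda')\pmod 4$, and let $u(n)=p(n)-t(n)$. For complex $a,q$ with $|q|<1$ write $(a;q)_\infty=\prod_{k\ge 0}(1-aq^k)$. Then for every complex number $q$ with $|q|<1$ the series $\sum_{n\ge 0}u(n)q^n$ converges, and $$\sum_{n=0}^{\infty}u(n)q^n=\frac{2q^2\,(q^2;q^2)_\infty^2\,(q^8;q^8)_\infty^2\,(q^{32};q^{32})_\infty^2}{(q;q)_\infty\,(q^4;q^4)_\infty^5\,(q^{16};q^{16})_\infty}.$$ -/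

import Mathlib

namespace StanleyPartition

/-- The parts of the conjugate partition: for `i = 1, …, n` the number of parts of `l` that are at
least `i` (the zeros, if any, are removed in `conj`). -/
def conjParts {n : ℕ} (l : Nat.Partition n) : Multiset ℕ :=
  (Multiset.range n).map fun i => l.parts.countP fun a => i + 1 ≤ a

theorem sum_map_countP_le (n : ℕ) (s : Multiset ℕ) (h : ∀ a ∈ s, a ≤ n) :
    ((Multiset.range n).map fun i => s.countP fun a => i + 1 ≤ a).sum = s.sum := by
  induction s using Multiset.induction_on with
  | empty => simp
  | cons b s ih =>
    have hb : b ≤ n := h b (Multiset.mem_cons_self b s)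
    have key : ((Multiset.range n).map fun i => if i + 1 ≤ b then 1 else 0).sum = b := by
      change (∑ i ∈ Finset.range n, if i + 1 ≤ b then 1 else 0) = b
      rw [← Finset.card_filter]
      have : (Finset.range n).filter (fun i => i + 1 ≤ b) = Finset.range b := by
        ext i
        simp only [Finset.mem_filter, Finset.mem_range]
        omega
      rw [this, Finset.card_range]
    simp only [Multiset.countP_cons, Multiset.sum_map_add, Multiset.sum_cons]
    rw [ih fun a ha => h a (Multiset.mem_cons_of_mem ha), key, add_comm]

theorem sum_conjParts {n : ℕ} (l : Nat.Partition n) : (conjParts l).sum = n :=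
  (sum_map_countP_le n l.parts fun _ ha => Nat.Partition.le_of_mem_parts ha).trans l.parts_sum

/-- The conjugate partition, whose `i`-th part is the number of parts of `l` that are at
least `i`. -/
def conj {n : ℕ} (l : Nat.Partition n) : Nat.Partition n :=
  Nat.Partition.ofSums n (conjParts l) (sum_conjParts l)

/-- The number of odd parts of a partition (with multiplicity). -/
def oddParts {n : ℕ} (l : Nat.Partition n) : ℕ :=
  l.parts.countP Odd

/-- The number of partitions of `n`. -/
def p (n : ℕ) : ℕ := Fintype.card (Nat.Partition n)

/-- Stanley's partition function: the number of partitions of `n` whose number of odd parts is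
congruent modulo `4` to the number of odd parts of the conjugate. -/
def t (n : ℕ) : ℕ :=
  (Finset.univ.filter fun l : Nat.Partition n => oddParts l ≡ oddParts (conj l) [MOD 4]).card

/-- The complementary partition function, as an integer. -/
def u (n : ℕ) : ℤ := (p n : ℤ) - (t n : ℤ)

/-- The infinite `q`-shifted factorial `(a; q)_∞ = (1 - a)(1 - a q)(1 - a q ^ 2) ⋯`. -/
noncomputable def qPoch (a q : ℂ) : ℂ := ∏' k : ℕ, (1 - a * q ^ k)

/-- The product defining `(a; q)_∞` converges for `|q| < 1`. -/
theorem multipliable_qPoch (a : ℂ) {q : ℂ} (hq : ‖q‖ < 1) :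
    Multipliable fun k : ℕ => 1 - a * q ^ k := by
  have h : Summable fun k : ℕ => ‖-(a * q ^ k)‖ := by
    simp only [norm_neg, norm_mul, norm_pow]
    exact (summable_geometric_of_lt_one (norm_nonneg q) hq).mul_left _
  simpa [sub_eq_add_neg] using multipliable_one_add_of_summable h

end StanleyPartition

namespace StanleyPartition

/-! Write `O` for the number of odd parts. Both `O(λ)` and `O(λ')` have the parity of `n`, so the
weight `i ^ (O(λ') - O(λ))` is `1` on the partitions counted by `t` and `-1` on the others. Hence `2
u(n)` is `p(n)` minus the weighted count (`stanleyWeight_parts`, `u_eq`).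

Let `F_s(q)` be the weighted generating function of the partitions with parts at most `s`, and
adjoin `k` copies of the part `s + 1`. If `k` is even, no column changes parity; if `k` is odd, the
first `s` columns all do, which up to an explicit factor amounts to `q ↦ -q`. With `x = -q²` this
reads `(1 - x^(s+1)) F_{s+1}(q) = F_s(q) + (-1)^⌊(s+1)/2⌋ q^(s+1) F_s(-q)`. The theta sum
`boundedStanley` obeys the same recurrence (`boundedStanley_succ`), so it equals `F_s`
(`hasSum_boundedStanley`).

As `s = 2N → ∞`, Tannery's theorem and the Jacobi triple product give the limit
`(-q;q²)(q⁴;q⁴)/(-q²;-q²)²`, which is `φ(-q²)/((q;q) φ(q²))` for `φ(Q) = ∑ Q^(c²)`. Subtracting it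
from `1/(q;q)` leaves the numerator `φ(q²) - φ(-q²)`, a single product by `theta_difference`. -/

open Filter Topology Finset

/-! ### Finite and infinite `q`-shifted factorials. -/

/-- The finite `q`-shifted factorial `(a; q)_n`. -/
def finPoch {R : Type*} [CommRing R] (a q : R) (n : ℕ) : R := ∏ k ∈ range n, (1 - a * q ^ k)

theorem finPoch_succ {R : Type*} [CommRing R] (a q : R) (n : ℕ) :
    finPoch a q (n + 1) = finPoch a q n * (1 - a * q ^ n) := prod_range_succ _ _

theorem one_sub_mul_pow_ne_zero {𝕜 : Type*} [NormedField 𝕜] {x : 𝕜} (hx : ‖x‖ < 1) (k : ℕ) :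
    1 - x * x ^ k ≠ 0 := by
  intro h
  have h1 : x ^ (k + 1) = 1 := by rw [pow_succ']; exact (sub_eq_zero.mp h).symm
  have h2 : ‖x‖ ^ (k + 1) = 1 := by rw [← norm_pow, h1, norm_one]
  exact absurd h2 (pow_lt_one₀ (norm_nonneg x) hx (Nat.succ_ne_zero k)).ne

theorem finPoch_self_ne_zero {𝕜 : Type*} [NormedField 𝕜] {x : 𝕜} (hx : ‖x‖ < 1) (n : ℕ) :
    finPoch x x n ≠ 0 :=
  prod_ne_zero_iff.mpr fun k _ => one_sub_mul_pow_ne_zero hx k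

theorem tendsto_finPoch (a : ℂ) {q : ℂ} (hq : ‖q‖ < 1) :
    Tendsto (finPoch a q) atTop (𝓝 (qPoch a q)) :=
  (multipliable_qPoch a hq).hasProd.tendsto_prod_nat

theorem qPoch_self_ne_zero {x : ℂ} (hx : ‖x‖ < 1) : qPoch x x ≠ 0 := by
  have h : ∏' k : ℕ, (1 + -(x * x ^ k)) ≠ 0 := by
    refine tprod_one_add_ne_zero_of_summable (f := fun k : ℕ => -(x * x ^ k)) ?_ ?_
    · intro k
      rw [← sub_eq_add_neg]
      exact one_sub_mul_pow_ne_zero hx k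
    · simp only [norm_neg, norm_mul, norm_pow]
      exact (summable_geometric_of_lt_one (norm_nonneg x) hx).mul_left _
  simpa [qPoch, sub_eq_add_neg] using h

theorem tendsto_inv_finPoch_self {x : ℂ} (hx : ‖x‖ < 1) :
    Tendsto (fun n => (finPoch x x n)⁻¹) atTop (𝓝 (qPoch x x)⁻¹) :=
  (tendsto_finPoch x hx).inv₀ (qPoch_self_ne_zero hx)

theorem exists_norm_inv_finPoch_le {x : ℂ} (hx : ‖x‖ < 1) :
    ∃ C : ℝ, 0 ≤ C ∧ ∀ n, ‖(finPoch x x n)⁻¹‖ ≤ C := by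
  obtain ⟨C, hC⟩ := (tendsto_inv_finPoch_self hx).norm.bddAbove_range
  have h : ∀ n, ‖(finPoch x x n)⁻¹‖ ≤ C := fun n => hC ⟨n, rfl⟩
  exact ⟨C, (norm_nonneg _).trans (h 0), h⟩

/-! ### The finite `q`-binomial theorem. -/

/-- The basic recurrence for sums over `a + b = n` with denominators `(x; x)_a (x; x)_b`. -/
theorem antidiagonal_sum_recurrence {x : ℂ} (hx : ‖x‖ < 1) (f : ℕ → ℕ → ℂ) (n : ℕ) :
    (1 - x * x ^ n) * ∑ i ∈ antidiagonal (n + 1), f i.1 i.2 / (finPoch x x i.1 * finPoch x x i.2) =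
      ∑ i ∈ antidiagonal n,
        (f (i.1 + 1) i.2 + x ^ i.1 * f i.1 (i.2 + 1)) / (finPoch x x i.1 * finPoch x x i.2) := by
  -- `1 - x^(a+b) = (1 - x^a) + x^a (1 - x^b)`: each piece cancels the last factor of one
  -- denominator and vanishes at the end `a = 0` or `b = 0`.
  have key : ∀ i ∈ antidiagonal (n + 1),
      (1 - x * x ^ n) * (f i.1 i.2 / (finPoch x x i.1 * finPoch x x i.2)) =
        (1 - x ^ i.1) * (f i.1 i.2 / (finPoch x x i.1 * finPoch x x i.2)) +
        x ^ i.1 * (1 - x ^ i.2) * (f i.1 i.2 / (finPoch x x i.1 * finPoch x x i.2)) := by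
    intro i hi
    rw [← pow_succ', ← mem_antidiagonal.mp hi, pow_add]
    ring
  rw [mul_sum, sum_congr rfl key, sum_add_distrib, Nat.sum_antidiagonal_succ,
    Nat.sum_antidiagonal_succ']
  simp only [pow_zero, sub_self, zero_mul, mul_zero, zero_add]
  rw [← sum_add_distrib]
  refine sum_congr rfl fun i _ => ?_
  have h1 := finPoch_self_ne_zero hx i.1
  have h2 := finPoch_self_ne_zero hx i.2
  have h3 := one_sub_mul_pow_ne_zero hx i.1
  have h4 := one_sub_mul_pow_ne_zero hx i.2
  rw [finPoch_succ, finPoch_succ, pow_succ' x i.1, pow_succ' x i.2]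
  field_simp

/-- The finite `q`-binomial theorem. -/
theorem q_binomial_theorem {x : ℂ} (hx : ‖x‖ < 1) (n : ℕ) (z : ℂ) :
    ∑ i ∈ antidiagonal n,
        z ^ i.1 * x ^ (i.1.choose 2) / (finPoch x x i.1 * finPoch x x i.2) =
      finPoch (-z) x n / finPoch x x n := by
  induction n generalizing z with
  | zero => simp [finPoch]
  | succ n ih =>
    have h := antidiagonal_sum_recurrence hx (fun a _ => z ^ a * x ^ (a.choose 2)) n
    -- The recurrence brings out `1 + z` and replaces `z` by `z x`, so the induction must let `z`
    -- vary.
    have h1 : ∀ i ∈ antidiagonal n,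
        (z ^ (i.1 + 1) * x ^ ((i.1 + 1).choose 2) + x ^ i.1 * (z ^ i.1 * x ^ (i.1.choose 2))) /
          (finPoch x x i.1 * finPoch x x i.2) =
        (1 + z) * ((z * x) ^ i.1 * x ^ (i.1.choose 2) / (finPoch x x i.1 * finPoch x x i.2)) := by
      intro i _
      have : (i.1 + 1).choose 2 = i.1 + i.1.choose 2 := by
        rw [Nat.choose_succ_succ' i.1 1, Nat.choose_one_right]
      rw [this, pow_add, mul_pow]
      ring
    rw [sum_congr rfl h1, ← mul_sum, ih] at h
    have h2 := one_sub_mul_pow_ne_zero hx n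
    have h3 := finPoch_self_ne_zero hx n
    have h4 : finPoch (-z) x (n + 1) = (1 + z) * finPoch (-(z * x)) x n := by
      rw [finPoch, prod_range_succ', mul_comm]
      congr 1
      · ring
      · exact prod_congr rfl fun k _ => by ring
    rw [h4, finPoch_succ, eq_div_iff (mul_ne_zero h3 h2)]
    calc _ = ((1 - x * x ^ n) * _) * finPoch x x n := by ring
      _ = _ := by rw [h]; field_simp

/-! ### Tannery's theorem and the Jacobi triple product. -/

theorem sum_antidiagonal_two_mul (N : ℕ) (f : ℕ → ℕ → ℂ) :
    ∑ i ∈ antidiagonal (2 * N), f i.1 i.2 =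
      ∑ c ∈ Icc (-(N : ℤ)) N, f (N + c).toNat (N - c).toNat := by
  refine sum_bij' (fun i _ => (i.1 : ℤ) - N) (fun c _ => ((N + c).toNat, (N - c).toNat)) ?_ ?_ ?_ ?_
    ?_
  · intro i hi
    rw [HasAntidiagonal.mem_antidiagonal] at hi
    rw [mem_Icc]
    omega
  · intro c hc
    rw [mem_Icc] at hc
    rw [HasAntidiagonal.mem_antidiagonal]
    omega
  · intro i hi
    rw [HasAntidiagonal.mem_antidiagonal] at hi
    ext <;> simp only <;> omega
  · intro c hc
    rw [mem_Icc] at hc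
    simp only
    omega
  · intro i hi
    rw [HasAntidiagonal.mem_antidiagonal] at hi
    congr 1 <;> omega

/-- Tannery's theorem for sums with denominators `(x; x)_{N + c} (x; x)_{N - c}`. -/
theorem tendsto_sum_div_finPoch {x : ℂ} (hx : ‖x‖ < 1) {g : ℤ → ℂ} (hg : Summable fun c => ‖g c‖) :
    Tendsto (fun N : ℕ => ∑ c ∈ Icc (-(N : ℤ)) N,
        g c / (finPoch x x (N + c).toNat * finPoch x x (N - c).toNat)) atTop
      (𝓝 ((∑' c, g c) / qPoch x x ^ 2)) := by
  obtain ⟨C, hC0, hC⟩ := exists_norm_inv_finPoch_le hx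
  -- The terms are extended by zero to all of `ℤ`; they are dominated by `C² ‖g c‖`.
  set G : ℕ → ℤ → ℂ := fun N c => if c ∈ Icc (-(N : ℤ)) N then
    g c / (finPoch x x (N + c).toNat * finPoch x x (N - c).toNat) else 0 with hG
  have h1 : ∀ N : ℕ, ∑ c ∈ Icc (-(N : ℤ)) N,
        g c / (finPoch x x (N + c).toNat * finPoch x x (N - c).toNat) = ∑' c, G N c := by
    intro N
    rw [tsum_eq_sum (s := Icc (-(N : ℤ)) N) fun c hc => by simp only [hG, if_neg hc]]
    exact sum_congr rfl fun c hc => by simp only [hG, if_pos hc]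
  simp_rw [h1]
  rw [← tsum_div_const]
  refine tendsto_tsum_of_dominated_convergence (hg.mul_right (C * C)) ?_ ?_
  · intro c
    have t1 : Tendsto (fun N : ℕ => ((N : ℤ) + c).toNat) atTop atTop :=
      tendsto_atTop.mpr fun b => by
        filter_upwards [eventually_ge_atTop (b + c.natAbs)] with N hN
        omega
    have t2 : Tendsto (fun N : ℕ => ((N : ℤ) - c).toNat) atTop atTop :=
      tendsto_atTop.mpr fun b => by
        filter_upwards [eventually_ge_atTop (b + c.natAbs)] with N hN
        omega
    have t3 := (((tendsto_inv_finPoch_self hx).comp t1).mul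
      ((tendsto_inv_finPoch_self hx).comp t2)).const_mul (g c)
    have e : g c / qPoch x x ^ 2 = g c * ((qPoch x x)⁻¹ * (qPoch x x)⁻¹) := by
      rw [div_eq_mul_inv, sq, mul_inv]
    rw [e]
    refine t3.congr' ?_
    filter_upwards [eventually_ge_atTop c.natAbs] with N hN
    have hc : c ∈ Icc (-(N : ℤ)) N := by rw [mem_Icc]; omega
    simp only [hG, if_pos hc, Function.comp_apply, div_eq_mul_inv, mul_inv]
  · refine Eventually.of_forall fun N c => ?_
    by_cases hc : c ∈ Icc (-(N : ℤ)) N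
    · simp only [hG, if_pos hc]
      rw [div_eq_mul_inv, mul_inv, norm_mul, norm_mul]
      have := hC ((N : ℤ) + c).toNat
      have := hC ((N : ℤ) - c).toNat
      gcongr
    · simp only [hG, if_neg hc, norm_zero]
      positivity

/-- The binomial coefficient `d (d - 1) / 2` for an integer `d`. -/
def tri (d : ℤ) : ℕ := (d * (d - 1) / 2).toNat

theorem two_mul_tri (d : ℤ) : 2 * (tri d : ℤ) = d * (d - 1) := by
  have h0 : 0 ≤ d * (d - 1) := by
    rcases le_or_gt d 0 with h | h
    · exact mul_nonneg_of_nonpos_of_nonpos h (by omega)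
    · exact mul_nonneg h.le (by omega)
  have h2 : 2 ∣ d * (d - 1) := (Int.even_mul_pred_self d).two_dvd
  rw [tri, Int.toNat_of_nonneg (Int.ediv_nonneg h0 (by norm_num)), Int.mul_ediv_cancel' h2]

theorem summable_nat_pow_mul_pow_choose {r : ℝ} (hr0 : 0 < r) (hr : r < 1) {y : ℝ} (hy : 0 < y) :
    Summable fun n : ℕ => y ^ n * r ^ (n.choose 2) := by
  refine summable_of_ratio_test_tendsto_lt_one (l := 0) zero_lt_one ?_ ?_
  · exact Eventually.of_forall fun n => by positivity
  · have h : Tendsto (fun n : ℕ => y * r ^ n) atTop (𝓝 (y * 0)) :=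
      (tendsto_pow_atTop_nhds_zero_of_lt_one hr0.le hr).const_mul y
    rw [mul_zero] at h
    refine h.congr fun n => ?_
    have : (n + 1).choose 2 = n + n.choose 2 := by
      rw [Nat.choose_succ_succ' n 1, Nat.choose_one_right]
    rw [Real.norm_of_nonneg (by positivity), Real.norm_of_nonneg (by positivity), this, pow_succ,
      pow_add]
    field_simp

theorem tri_one_sub (d : ℤ) : tri (1 - d) = tri d := by
  have h := two_mul_tri d
  have h2 := two_mul_tri (1 - d)
  have : (1 - d) * (1 - d - 1) = d * (d - 1) := by ring
  omega

theorem tri_add_one (d : ℤ) : (tri (d + 1) : ℤ) = tri d + d := by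
  have h := two_mul_tri d
  have h2 := two_mul_tri (d + 1)
  have : (d + 1) * (d + 1 - 1) = d * (d - 1) + 2 * d := by ring
  omega

theorem tri_natCast (n : ℕ) : tri n = n.choose 2 := by
  induction n with
  | zero => rfl
  | succ n ih =>
    have h := tri_add_one n
    rw [Nat.choose_succ_succ' n 1, Nat.choose_one_right, ← ih]
    push_cast
    omega

theorem summable_theta {x z : ℂ} (hx0 : x ≠ 0) (hx : ‖x‖ < 1) (hz : z ≠ 0) :
    Summable fun c : ℤ => ‖z ^ c * x ^ tri c‖ := by
  have hx' := norm_pos_iff.mpr hx0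
  have hz' := norm_pos_iff.mpr hz
  refine Summable.of_nat_of_neg ?_ ?_
  · refine (summable_nat_pow_mul_pow_choose hx' hx hz').congr fun n => ?_
    rw [tri_natCast, zpow_natCast, norm_mul, norm_pow, norm_pow]
  · refine (summable_nat_pow_mul_pow_choose hx' hx
      (mul_pos (inv_pos.mpr hz') hx')).congr fun n => ?_
    have h : tri (-n) = n + n.choose 2 := by
      have h1 := tri_add_one (-n)
      have h2 := tri_one_sub n
      have h3 : -(n : ℤ) + 1 = 1 - n := by ring
      rw [h3, h2, tri_natCast] at h1
      omega
    rw [h, zpow_neg, zpow_natCast, norm_mul, norm_inv, norm_pow, norm_pow, mul_pow, inv_pow,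
      pow_add]
    ring

/-- For `j = 1, …, N` one has `1 + z x^(-j) = z x^(-j) (1 + x^j / z)`, and the exponents `j` add up
to `(N + 1).choose 2`. -/
theorem finPoch_shift {x z : ℂ} (hx0 : x ≠ 0) (hz : z ≠ 0) (N : ℕ) :
    finPoch (-(z * (x ^ N)⁻¹)) x N * x ^ ((N + 1).choose 2) = z ^ N * finPoch (-(x / z)) x N := by
  induction N with
  | zero => simp [finPoch]
  | succ N ih =>
    have h1 : finPoch (-(z * (x ^ (N + 1))⁻¹)) x (N + 1) =
        finPoch (-(z * (x ^ N)⁻¹)) x N * (1 + z * (x ^ (N + 1))⁻¹) := by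
      rw [finPoch, prod_range_succ']
      congr 1
      · refine prod_congr rfl fun k _ => ?_
        field_simp
        ring
      · ring
    have h2 : (N + 1 + 1).choose 2 = (N + 1) + (N + 1).choose 2 := by
      rw [Nat.choose_succ_succ' (N + 1) 1, Nat.choose_one_right]
    rw [h1, h2, finPoch_succ, pow_add]
    calc _ = (finPoch (-(z * (x ^ N)⁻¹)) x N * x ^ ((N + 1).choose 2)) *
          ((1 + z * (x ^ (N + 1))⁻¹) * x ^ (N + 1)) := by ring
      _ = _ := by
        rw [ih]
        field_simp
        ring

theorem tri_add (a b : ℤ) : (tri (a + b) : ℤ) = tri a + tri b + a * b := by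
  have h1 := two_mul_tri (a + b)
  have h2 := two_mul_tri a
  have h3 := two_mul_tri b
  linarith

/-- The finite form of the Jacobi triple product identity. -/
theorem finite_triple_product {x z : ℂ} (hx0 : x ≠ 0) (hx : ‖x‖ < 1) (hz : z ≠ 0) (N : ℕ) :
    ∑ c ∈ Icc (-(N : ℤ)) N,
        z ^ c * x ^ tri c / (finPoch x x (N + c).toNat * finPoch x x (N - c).toNat) =
      finPoch (-z) x N * finPoch (-(x / z)) x N / finPoch x x (2 * N) := by
  -- The shift of `z` by `x^(-N)` centres the `2N + 1` terms at `c = 0`.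
  have hb := q_binomial_theorem hx (2 * N) (z * (x ^ N)⁻¹)
  rw [sum_antidiagonal_two_mul N fun a b => (z * (x ^ N)⁻¹) ^ a * x ^ (a.choose 2) /
    (finPoch x x a * finPoch x x b)] at hb
  have hs : finPoch (-(z * (x ^ N)⁻¹)) x (2 * N) =
      finPoch (-(z * (x ^ N)⁻¹)) x N * finPoch (-z) x N := by
    rw [two_mul, finPoch, prod_range_add]
    congr 1
    refine prod_congr rfl fun k _ => ?_
    rw [pow_add]
    field_simp
  have hterm : ∀ c ∈ Icc (-(N : ℤ)) N, (z * (x ^ N)⁻¹) ^ (N + c).toNat *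
      x ^ ((N + c).toNat.choose 2) / (finPoch x x (N + c).toNat * finPoch x x (N - c).toNat) =
      z ^ N / x ^ ((N + 1).choose 2) *
        (z ^ c * x ^ tri c / (finPoch x x (N + c).toNat * finPoch x x (N - c).toNat)) := by
    intro c hc
    rw [mem_Icc] at hc
    have hcast : (((N : ℤ) + c).toNat : ℤ) = N + c := Int.toNat_of_nonneg (by omega)
    rw [← mul_div_assoc]
    congr 1
    rw [← tri_natCast, hcast, ← zpow_natCast (z * (x ^ N)⁻¹), hcast, mul_zpow, zpow_add₀ hz,
      zpow_natCast]
    have hexp : ((x ^ N)⁻¹) ^ ((N : ℤ) + c) * x ^ tri (N + c) * x ^ ((N + 1).choose 2) =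
        x ^ tri c := by
      rw [← tri_natCast, ← zpow_natCast x N, ← zpow_neg, ← zpow_mul, ← zpow_natCast x (tri _),
        ← zpow_natCast x (tri _), ← zpow_natCast x (tri _), ← zpow_add₀ hx0, ← zpow_add₀ hx0]
      congr 1
      have h1 := tri_add N c
      have h2 := tri_add_one N
      have h3 := two_mul_tri N
      push_cast
      rw [h1, h2]
      linarith
    rw [div_mul_eq_mul_div, eq_div_iff (pow_ne_zero _ hx0), ← hexp]
    ring
  rw [sum_congr rfl hterm, ← mul_sum, hs] at hb
  have hK : z ^ N / x ^ ((N + 1).choose 2) ≠ 0 :=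
    div_ne_zero (pow_ne_zero _ hz) (pow_ne_zero _ hx0)
  refine mul_left_cancel₀ hK (hb.trans ?_)
  have hsh := finPoch_shift hx0 hz N
  rw [← eq_div_iff (pow_ne_zero _ hx0)] at hsh
  rw [hsh]
  ring

/-- The Jacobi triple product identity. -/
theorem jacobi_triple_product {x z : ℂ} (hx0 : x ≠ 0) (hx : ‖x‖ < 1) (hz : z ≠ 0) :
    HasSum (fun c : ℤ => z ^ c * x ^ tri c)
      (qPoch (-z) x * qPoch (-(x / z)) x * qPoch x x) := by
  have hsum := summable_theta hx0 hx hz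
  have h1 := tendsto_sum_div_finPoch hx hsum
  simp_rw [finite_triple_product hx0 hx hz] at h1
  have h2 : Tendsto (fun N : ℕ => finPoch x x (2 * N)) atTop (𝓝 (qPoch x x)) :=
    (tendsto_finPoch x hx).comp (tendsto_atTop_mono (fun n => Nat.le_mul_of_pos_left n two_pos) tendsto_id)
  have hne := qPoch_self_ne_zero hx
  have h3 := tendsto_nhds_unique h1
    (((tendsto_finPoch (-z) hx).mul (tendsto_finPoch (-(x / z)) hx)).div h2 hne)
  have h4 : ∑' c : ℤ, z ^ c * x ^ tri c = qPoch (-z) x * qPoch (-(x / z)) x * qPoch x x := by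
    field_simp at h3
    rw [h3]
    ring
  rw [← h4]
  exact hsum.of_norm.hasSum

/-! ### Generating functions of partitions with bounded parts. -/

/-- The multisets of positive integers that are at most `s`. -/
def boundedParts (s : ℕ) : Set (Multiset ℕ) := {μ | ∀ a ∈ μ, 0 < a ∧ a ≤ s}

/-- A multiset of positive integers at most `s + 1` is given by the multiplicity of `s + 1` and a
multiset of positive integers at most `s`. -/
def adjoinParts (s : ℕ) : ℕ × boundedParts s ≃ boundedParts (s + 1) where
  toFun i := ⟨Multiset.replicate i.1 (s + 1) + i.2.1, by
    intro a ha
    rcases Multiset.mem_add.mp ha with h | h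
    · rw [Multiset.eq_of_mem_replicate h]
      omega
    · have := i.2.2 a h
      omega⟩
  invFun μ := (Multiset.count (s + 1) μ.1, ⟨μ.1.filter (fun a => ¬ a = s + 1), by
    intro a ha
    rw [Multiset.mem_filter] at ha
    have := μ.2 a ha.1
    omega⟩)
  left_inv := by
    rintro ⟨k, μ, hμ⟩
    have h : ∀ a ∈ μ, ¬ a = s + 1 := fun a ha => by
      have := hμ a ha
      omega
    have h1 : Multiset.count (s + 1) μ = 0 := Multiset.count_eq_zero.mpr fun ha => h _ ha rfl
    ext1
    · simp [h1]
    · ext1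
      simp only [Multiset.filter_add, Multiset.filter_eq_self.mpr h]
      rw [Multiset.filter_eq_nil.mpr, zero_add]
      intro a ha
      simpa using Multiset.eq_of_mem_replicate ha
  right_inv := by
    rintro ⟨μ, hμ⟩
    ext1
    simp only
    rw [← Multiset.filter_eq', Multiset.filter_add_not]

theorem adjoinParts_coe (s k : ℕ) (μ : boundedParts s) :
    (adjoinParts s (k, μ) : Multiset ℕ) = Multiset.replicate k (s + 1) + μ := rfl

theorem sum_adjoinParts (s k : ℕ) (μ : boundedParts s) :
    (adjoinParts s (k, μ) : Multiset ℕ).sum = k * (s + 1) + μ.1.sum := by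
  rw [adjoinParts_coe, Multiset.sum_add, Multiset.sum_replicate, smul_eq_mul]

theorem boundedParts_zero : boundedParts 0 = {0} := by
  ext μ
  simp only [boundedParts, Set.mem_ofPred_eq, Set.mem_singleton_iff]
  constructor
  · intro h
    refine Multiset.eq_zero_of_forall_notMem fun a ha => ?_
    have := h a ha
    omega
  · rintro rfl
    simp

theorem hasSum_boundedParts_zero {R : Type*} [AddCommMonoid R] [TopologicalSpace R]
    (f : Multiset ℕ → R) : HasSum (fun μ : boundedParts 0 => f μ) (f 0) := by
  rw [boundedParts_zero]
  exact hasSum_unique (fun μ : ({0} : Set (Multiset ℕ)) => f μ)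

theorem hasSum_mul_of_hasSum {𝕜 ι κ : Type*} [RCLike 𝕜] {f : ι → 𝕜} {g : κ → 𝕜} {a b : 𝕜}
    (hf : HasSum f a) (hg : HasSum g b) :
    HasSum (fun i : ι × κ => f i.1 * g i.2) (a * b) :=
  hf.mul hg (summable_mul_of_summable_norm hf.summable.norm hg.summable.norm)

/-- The generating function of the partitions with all parts at most `s`. -/
theorem hasSum_pow_sum {𝕜 : Type*} [RCLike 𝕜] {q : 𝕜} (hq : ‖q‖ < 1) (s : ℕ) :
    (Summable fun μ : boundedParts s => ‖q ^ μ.1.sum‖) ∧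
      HasSum (fun μ : boundedParts s => q ^ μ.1.sum) (finPoch q q s)⁻¹ := by
  induction s with
  | zero =>
    refine ⟨(hasSum_boundedParts_zero fun μ => ‖q ^ μ.sum‖).summable, ?_⟩
    simpa [finPoch] using hasSum_boundedParts_zero fun μ => q ^ μ.sum
  | succ s ih =>
    obtain ⟨ih1, ih2⟩ := ih
    have hq' : ‖q * q ^ s‖ < 1 := by
      rw [← pow_succ', norm_pow]
      exact pow_lt_one₀ (norm_nonneg q) hq (Nat.succ_ne_zero s)
    have hg := hasSum_geometric_of_norm_lt_one hq'
    have hgn : Summable fun k : ℕ => ‖(q * q ^ s) ^ k‖ := hg.summable.norm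
    have e : ∀ i : ℕ × boundedParts s, q ^ (adjoinParts s i).1.sum =
        (q * q ^ s) ^ i.1 * q ^ i.2.1.sum := by
      rintro ⟨k, μ⟩
      rw [sum_adjoinParts, pow_add, ← pow_succ', ← pow_mul, mul_comm k]
    have hn : Summable fun i : ℕ × boundedParts s => ‖(q * q ^ s) ^ i.1 * q ^ i.2.1.sum‖ :=
      (hgn.mul_of_nonneg ih1 (fun _ => norm_nonneg _) fun _ => norm_nonneg _).congr
        fun _ => (norm_mul _ _).symm
    rw [← (adjoinParts s).summable_iff, ← (adjoinParts s).hasSum_iff]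
    simp only [Function.comp_def, e]
    refine ⟨hn, ?_⟩
    rw [finPoch_succ, mul_inv, mul_comm (finPoch q q s)⁻¹]
    exact hasSum_mul_of_hasSum (f := fun k => (q * q ^ s) ^ k)
      (g := fun μ : boundedParts s => q ^ μ.1.sum) hg ih2

/-- The multisets of positive integers. -/
def positiveParts : Set (Multiset ℕ) := {μ | ∀ a ∈ μ, 0 < a}

theorem boundedParts_subset (s : ℕ) : boundedParts s ⊆ positiveParts := fun _ h a ha => (h a ha).1

theorem mem_boundedParts_of_sum_le {μ : Multiset ℕ} (hμ : μ ∈ positiveParts) {s : ℕ}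
    (h : μ.sum ≤ s) : μ ∈ boundedParts s := fun a ha =>
  ⟨hμ a ha, (Multiset.single_le_sum (fun _ _ => Nat.zero_le _) a ha).trans h⟩

/-- Partitions of all natural numbers are multisets of positive integers. -/
def sigmaPartitionEquiv : (Σ n, Nat.Partition n) ≃ positiveParts where
  toFun l := ⟨l.2.parts, fun _ ha => l.2.parts_pos ha⟩
  invFun μ := ⟨μ.1.sum, ⟨μ.1, fun ha => μ.2 _ ha, rfl⟩⟩
  left_inv := by
    rintro ⟨n, μ, h1, rfl⟩
    rfl
  right_inv _ := rfl

/-- Any finite set of partitions has its parts bounded by some `s`, so its sum is at most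
`1/(r;r)_s`; these values converge, hence are bounded. -/
theorem summable_positiveParts {r : ℝ} (hr0 : 0 ≤ r) (hr : r < 1) :
    Summable fun μ : positiveParts => r ^ μ.1.sum := by
  have hr' : ‖r‖ < 1 := by rwa [Real.norm_of_nonneg hr0]
  have hrc : ‖(r : ℂ)‖ < 1 := by rwa [Complex.norm_real]
  obtain ⟨C, -, hC⟩ := exists_norm_inv_finPoch_le hrc
  have hC' : ∀ s, (finPoch r r s)⁻¹ ≤ C := fun s => by
    have h := hC s
    have e : finPoch (r : ℂ) r s = (finPoch r r s : ℝ) := by simp [finPoch]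
    rw [e, ← Complex.ofReal_inv, Complex.norm_real] at h
    exact (le_abs_self _).trans h
  refine summable_of_sum_le (c := C) (fun μ => pow_nonneg hr0 _) fun t => ?_
  set s := t.sup fun μ => μ.1.sum
  refine le_trans ?_ (hC' s)
  have hmem : ∀ μ ∈ t, μ.1 ∈ boundedParts s := fun μ hμ =>
    mem_boundedParts_of_sum_le μ.2 (le_sup (f := fun μ : positiveParts => μ.1.sum) hμ)
  have h := (hasSum_pow_sum hr' s).2
  replace h := (hasSum_subtype_iff_indicator (f := fun μ : Multiset ℕ => r ^ μ.sum)).mp h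
  have hnonneg : ∀ μ : Multiset ℕ, 0 ≤ (boundedParts s).indicator (fun μ => r ^ μ.sum) μ :=
    Set.indicator_nonneg fun μ _ => pow_nonneg hr0 _
  refine le_trans (le_of_eq ?_)
    (sum_le_hasSum (t.map (Function.Embedding.subtype _)) (fun μ _ => hnonneg μ) h)
  rw [sum_map]
  refine sum_congr rfl fun μ hμ => ?_
  exact (Set.indicator_of_mem (hmem μ hμ) fun μ : Multiset ℕ => r ^ μ.sum).symm

/-- A weighted generating function of partitions is the limit of the generating functions of the
partitions with bounded parts. -/
theorem hasSum_partition_of_tendsto {w : Multiset ℕ → ℂ} (hw : ∀ μ, ‖w μ‖ ≤ 1) {q : ℂ}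
    (hq : ‖q‖ < 1) {A : ℕ → ℂ}
    (hA : ∀ s, HasSum (fun μ : boundedParts s => w μ * q ^ μ.1.sum) (A s))
    {φ : ℕ → ℕ} (hφ : Tendsto φ atTop atTop) {L : ℂ}
    (hL : Tendsto (fun N => A (φ N)) atTop (𝓝 L)) :
    HasSum (fun n => (∑ l : Nat.Partition n, w l.parts) * q ^ n) L := by
  have hpos := summable_positiveParts (norm_nonneg q) hq
  have hle : ∀ μ : Multiset ℕ, ‖w μ * q ^ μ.sum‖ ≤ ‖q‖ ^ μ.sum := fun μ => by
    rw [norm_mul, norm_pow]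
    exact mul_le_of_le_one_left (by positivity) (hw μ)
  have hsum : Summable fun μ : positiveParts => w μ * q ^ μ.1.sum :=
    Summable.of_norm_bounded hpos fun μ => hle μ
  have hlim : Tendsto A atTop (𝓝 (∑' μ : positiveParts, w μ * q ^ μ.1.sum)) := by
    have e : ∀ s, A s = ∑' μ : Multiset ℕ,
        (boundedParts s).indicator (fun μ => w μ * q ^ μ.sum) μ := fun s => by
      rw [← _root_.tsum_subtype]
      exact (hA s).tsum_eq.symm
    rw [_root_.tsum_subtype positiveParts fun μ => w μ * q ^ μ.sum, funext e]
    replace hpos := (summable_subtype_iff_indicator (f := fun μ : Multiset ℕ => ‖q‖ ^ μ.sum)).mp hpos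
    refine tendsto_tsum_of_dominated_convergence hpos ?_ ?_
    · intro μ
      refine tendsto_const_nhds.congr' ?_
      filter_upwards [eventually_ge_atTop μ.sum] with s hs
      by_cases hμ : μ ∈ positiveParts
      · rw [Set.indicator_of_mem hμ, Set.indicator_of_mem (mem_boundedParts_of_sum_le hμ hs)]
      · rw [Set.indicator_of_notMem hμ,
          Set.indicator_of_notMem fun h => hμ (boundedParts_subset s h)]
    · refine Eventually.of_forall fun s μ => ?_
      rw [norm_indicator_eq_indicator_norm]
      exact (Set.indicator_le_indicator (hle μ)).trans
        (Set.indicator_le_indicator_of_subset (boundedParts_subset s)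
          (fun _ => by positivity) μ)
  have hval := tendsto_nhds_unique hL (hlim.comp hφ)
  rw [hval]
  have hs := hsum.hasSum
  rw [← sigmaPartitionEquiv.hasSum_iff] at hs
  have hs' := hs.sigma (fun n => hasSum_fintype _)
  refine hs'.congr_fun fun n => ?_
  rw [sum_mul]
  exact sum_congr rfl fun l _ => by
    simp only [Function.comp_apply, sigmaPartitionEquiv, Equiv.coe_fn_mk, l.parts_sum]

/-! ### The weight, and its behaviour when the part `s + 1` is adjoined. -/

/-- The product over the columns of length at most `N` of `ζ` for each column of odd length. -/
noncomputable def columnFactor (ζ : ℂ) (μ : Multiset ℕ) (N : ℕ) : ℂ :=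
  ∏ i ∈ range N, if Odd (μ.countP fun a => i + 1 ≤ a) then ζ else 1

/-- The weight `i ^ (O(λ') - O(λ))`. -/
noncomputable def stanleyWeight (μ : Multiset ℕ) : ℂ :=
  columnFactor Complex.I μ μ.sum * (-Complex.I) ^ μ.countP Odd

theorem columnFactor_eq_of_le (ζ : ℂ) {μ : Multiset ℕ} {N M : ℕ} (hN : ∀ a ∈ μ, a ≤ N)
    (h : N ≤ M) : columnFactor ζ μ M = columnFactor ζ μ N := by
  symm
  refine prod_subset (range_mono h) fun i _ hi => ?_
  rw [mem_range] at hi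
  rw [Multiset.countP_eq_zero.mpr fun a ha => by have := hN a ha; omega]
  simp

theorem columnFactor_eq (ζ : ℂ) {μ : Multiset ℕ} {N : ℕ} (hN : ∀ a ∈ μ, a ≤ N) :
    columnFactor ζ μ μ.sum = columnFactor ζ μ N := by
  have h : ∀ a ∈ μ, a ≤ μ.sum := fun a ha =>
    Multiset.single_le_sum (fun _ _ => Nat.zero_le _) a ha
  rcases le_total N μ.sum with h' | h'
  · exact columnFactor_eq_of_le ζ hN h'
  · exact (columnFactor_eq_of_le ζ h h').symm

theorem norm_stanleyWeight_le (μ : Multiset ℕ) : ‖stanleyWeight μ‖ ≤ 1 := by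
  rw [stanleyWeight, columnFactor, norm_mul, norm_prod, norm_pow, norm_neg, Complex.norm_I,
    one_pow, mul_one]
  refine prod_le_one (fun _ _ => norm_nonneg _) fun i _ => ?_
  split_ifs <;> simp

/-- The column lengths add up to `μ.sum`. This is what turns a change of column parities into `q ↦
-q`. -/
theorem columnFactor_neg_one {μ : Multiset ℕ} {N : ℕ} (hN : ∀ a ∈ μ, a ≤ N) :
    columnFactor (-1) μ N = (-1) ^ μ.sum := by
  rw [← sum_map_countP_le N μ hN]
  change _ = (-1) ^ (∑ i ∈ range N, μ.countP fun a => i + 1 ≤ a)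
  rw [← prod_pow_eq_pow_sum]
  refine prod_congr rfl fun i _ => ?_
  split_ifs with h
  · exact h.neg_one_pow.symm
  · exact (Nat.not_odd_iff_even.mp h).neg_one_pow.symm

theorem columnFactor_neg_I (μ : Multiset ℕ) (N : ℕ) :
    columnFactor (-Complex.I) μ N = columnFactor Complex.I μ N * columnFactor (-1) μ N := by
  rw [columnFactor, columnFactor, columnFactor, ← prod_mul_distrib]
  refine prod_congr rfl fun i _ => ?_
  split_ifs <;> simp

theorem countP_replicate_add_of_lt {s i k : ℕ} (hi : i < s + 1) (μ : Multiset ℕ) :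
    (Multiset.replicate k (s + 1) + μ).countP (fun a => i + 1 ≤ a) =
      k + μ.countP fun a => i + 1 ≤ a := by
  rw [Multiset.countP_add, Multiset.countP_eq_card.mpr, Multiset.card_replicate]
  intro a ha
  rw [Multiset.eq_of_mem_replicate ha]
  omega

theorem countP_last {s : ℕ} {μ : Multiset ℕ} (hμ : μ ∈ boundedParts s) :
    μ.countP (fun a => s + 1 ≤ a) = 0 :=
  Multiset.countP_eq_zero.mpr fun a ha => by
    have := hμ a ha
    omega

theorem columnFactor_replicate_even (ζ : ℂ) {s : ℕ} {μ : Multiset ℕ} (hμ : μ ∈ boundedParts s)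
    {k : ℕ} (hk : Even k) :
    columnFactor ζ (Multiset.replicate k (s + 1) + μ) (s + 1) = columnFactor ζ μ s := by
  rw [columnFactor, prod_range_succ, countP_replicate_add_of_lt (Nat.lt_succ_self s),
    countP_last hμ, add_zero, if_neg (Nat.not_odd_iff_even.mpr hk), mul_one]
  refine prod_congr rfl fun i hi => ?_
  rw [countP_replicate_add_of_lt ((mem_range.mp hi).trans (Nat.lt_succ_self s))]
  simp only [Nat.odd_add', hk, iff_true]

/-- Every old column changes parity; since `I * (-I) = 1`, taking out `I` from each of them leaves
the factor for `-I`. The new column has odd length `k` and gives one more `I`. -/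
theorem columnFactor_replicate_odd {s : ℕ} {μ : Multiset ℕ} (hμ : μ ∈ boundedParts s)
    {k : ℕ} (hk : Odd k) :
    columnFactor Complex.I (Multiset.replicate k (s + 1) + μ) (s + 1) =
      Complex.I ^ (s + 1) * columnFactor (-Complex.I) μ s := by
  rw [columnFactor, prod_range_succ, countP_replicate_add_of_lt (Nat.lt_succ_self s),
    countP_last hμ, add_zero, if_pos hk, pow_succ, mul_right_comm]
  congr 1
  have hc : Complex.I ^ s = ∏ _i ∈ range s, Complex.I := by rw [prod_const, card_range]
  rw [hc, columnFactor, ← prod_mul_distrib]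
  refine prod_congr rfl fun i hi => ?_
  rw [countP_replicate_add_of_lt ((mem_range.mp hi).trans (Nat.lt_succ_self s))]
  by_cases h : Odd (μ.countP fun a => i + 1 ≤ a)
  · rw [if_neg (Nat.not_odd_iff_even.mpr (hk.add_odd h)), if_pos h]
    simp
  · rw [if_pos (hk.add_even (Nat.not_odd_iff_even.mp h)), if_neg h, mul_one]

theorem stanleyWeight_eq {s : ℕ} {μ : Multiset ℕ} (hμ : μ ∈ boundedParts s) :
    stanleyWeight μ = columnFactor Complex.I μ s * (-Complex.I) ^ μ.countP Odd := by
  rw [stanleyWeight, columnFactor_eq _ fun a ha => (hμ a ha).2]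

theorem neg_I_pow_countP_replicate (s k : ℕ) :
    (-Complex.I) ^ (Multiset.replicate k (s + 1)).countP Odd =
      if Odd (s + 1) then (-Complex.I) ^ k else 1 := by
  split_ifs with h
  · rw [Multiset.countP_eq_card.mpr, Multiset.card_replicate]
    intro a ha
    rwa [Multiset.eq_of_mem_replicate ha]
  · rw [Multiset.countP_eq_zero.mpr, pow_zero]
    intro a ha
    rwa [Multiset.eq_of_mem_replicate ha]

/-- The sign is exactly the weight `(-I)^(2j)` of `2j` parts `s + 1`, which is present only when `s
+ 1` is odd. -/
theorem neg_sq_pow_pow (q : ℂ) (s j : ℕ) : (-q ^ 2 * (-q ^ 2) ^ s) ^ j =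
    (if Odd (s + 1) then (-1) ^ j else 1) * q ^ (2 * (s + 1) * j) := by
  rw [← pow_succ', neg_pow (q ^ 2) (s + 1), mul_pow, ← pow_mul q, ← pow_mul q]
  congr 1
  split_ifs with h
  · rw [h.neg_one_pow]
  · rw [(Nat.not_odd_iff_even.mp h).neg_one_pow, one_pow]

theorem stanleyWeight_adjoin_even {s : ℕ} (μ : boundedParts s) (j : ℕ) (q : ℂ) :
    stanleyWeight (adjoinParts s (2 * j, μ)).1 * q ^ (adjoinParts s (2 * j, μ)).1.sum =
      (-q ^ 2 * (-q ^ 2) ^ s) ^ j * (stanleyWeight μ * q ^ μ.1.sum) := by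
  rw [stanleyWeight_eq (adjoinParts s (2 * j, μ)).2, sum_adjoinParts, adjoinParts_coe,
    columnFactor_replicate_even _ μ.2 (even_two_mul j), stanleyWeight_eq μ.2, Multiset.countP_add,
    pow_add (-Complex.I), neg_I_pow_countP_replicate]
  have h : (if Odd (s + 1) then (-Complex.I) ^ (2 * j) else 1) * q ^ (2 * j * (s + 1)) =
      (-q ^ 2 * (-q ^ 2) ^ s) ^ j := by
    rw [neg_sq_pow_pow, mul_right_comm 2 j, pow_mul (-Complex.I), neg_sq, Complex.I_sq]
  rw [← h, pow_add]
  ring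

theorem I_pow_mul_neg_I_pow (n : ℕ) :
    Complex.I ^ n * (if Odd n then -Complex.I else 1) = (-1) ^ (n / 2) := by
  obtain ⟨m, rfl | rfl⟩ := n.even_or_odd'
  · rw [if_neg (Nat.not_odd_iff_even.mpr (even_two_mul m)), pow_mul, Complex.I_sq, mul_one,
      Nat.mul_div_cancel_left m two_pos]
  · rw [if_pos (odd_two_mul_add_one m), pow_succ, pow_mul, Complex.I_sq, mul_assoc,
      show (2 * m + 1) / 2 = m by omega]
    simp

theorem stanleyWeight_adjoin_odd {s : ℕ} (μ : boundedParts s) (j : ℕ) (q : ℂ) :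
    stanleyWeight (adjoinParts s (2 * j + 1, μ)).1 * q ^ (adjoinParts s (2 * j + 1, μ)).1.sum =
      (-1) ^ ((s + 1) / 2) * q ^ (s + 1) * (-q ^ 2 * (-q ^ 2) ^ s) ^ j *
        (stanleyWeight μ * (-q) ^ μ.1.sum) := by
  rw [stanleyWeight_eq (adjoinParts s (2 * j + 1, μ)).2, sum_adjoinParts, adjoinParts_coe,
    columnFactor_replicate_odd μ.2 (odd_two_mul_add_one j), stanleyWeight_eq μ.2,
    Multiset.countP_add, pow_add (-Complex.I), neg_I_pow_countP_replicate, columnFactor_neg_I,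
    columnFactor_neg_one fun a ha => (μ.2 a ha).2, neg_pow q μ.1.sum, ← I_pow_mul_neg_I_pow]
  have h : (if Odd (s + 1) then (-Complex.I) ^ (2 * j + 1) else 1) * q ^ ((2 * j + 1) * (s + 1)) =
      (if Odd (s + 1) then -Complex.I else 1) * q ^ (s + 1) * (-q ^ 2 * (-q ^ 2) ^ s) ^ j := by
    rw [neg_sq_pow_pow, show (2 * j + 1) * (s + 1) = (s + 1) + 2 * (s + 1) * j by ring, pow_succ,
      pow_mul (-Complex.I), neg_sq, Complex.I_sq]
    split_ifs <;> ring
  rw [pow_add]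
  calc _ = Complex.I ^ (s + 1) * ((if Odd (s + 1) then (-Complex.I) ^ (2 * j + 1) else 1) *
        q ^ ((2 * j + 1) * (s + 1))) * (columnFactor Complex.I μ s * (-1) ^ μ.1.sum *
        (-Complex.I) ^ μ.1.countP Odd * q ^ μ.1.sum) := by ring
    _ = _ := by
      rw [h]
      ring

/-! ### The theta sum for bounded parts. -/

/-- The finite theta sum that is the signed generating function of the partitions with all parts at
most `s`. -/
noncomputable def boundedStanley (q : ℂ) (s : ℕ) : ℂ :=
  ∑ i ∈ antidiagonal s, q ^ tri ((i.1 : ℤ) - i.2) /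
    (finPoch (-q ^ 2) (-q ^ 2) i.1 * finPoch (-q ^ 2) (-q ^ 2) i.2)

theorem norm_neg_sq_lt_one {q : ℂ} (hq : ‖q‖ < 1) : ‖-q ^ 2‖ < 1 := by
  rw [norm_neg, norm_pow]
  exact pow_lt_one₀ (norm_nonneg q) hq two_ne_zero

/-- The parity of `tri d` depends only on `d` modulo `4`, so the four residues of `a - b` suffice.
-/
theorem neg_one_pow_tri (a b : ℕ) :
    ((-1 : ℂ)) ^ ((a + b + 1) / 2) * (-1) ^ tri ((a : ℤ) - b) = (-1) ^ a := by
  rw [← pow_add, neg_one_pow_eq_pow_mod_two, neg_one_pow_eq_pow_mod_two a]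
  congr 1
  have h := two_mul_tri ((a : ℤ) - b)
  obtain ⟨l, r, hr0, hr4, hd⟩ : ∃ l r : ℤ, 0 ≤ r ∧ r < 4 ∧ (a : ℤ) - b = 4 * l + r :=
    ⟨((a : ℤ) - b) / 4, ((a : ℤ) - b) % 4, by omega, by omega, by omega⟩
  have e : ((a : ℤ) - b) * (a - b - 1) = 16 * (l * l) + 8 * (l * r) - 4 * l + r * (r - 1) := by
    rw [hd]
    ring
  rw [e] at h
  interval_cases r <;> omega

theorem boundedStanley_succ {q : ℂ} (hq : ‖q‖ < 1) (s : ℕ) :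
    (1 - -q ^ 2 * (-q ^ 2) ^ s) * boundedStanley q (s + 1) =
      boundedStanley q s + (-1) ^ ((s + 1) / 2) * q ^ (s + 1) * boundedStanley (-q) s := by
  have hx := norm_neg_sq_lt_one hq
  rw [boundedStanley, antidiagonal_sum_recurrence hx (fun a b => q ^ tri ((a : ℤ) - b)) s]
  simp only [add_div, sum_add_distrib]
  congr 1
  -- Since `tri (a + 1 - b) = tri (b - a)`, exchanging `a` and `b` gives back the sum for `s`.
  · rw [boundedStanley, ← Nat.sum_antidiagonal_swap]
    refine sum_congr rfl fun i _ => ?_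
    rw [mul_comm (finPoch _ _ i.1), ← tri_one_sub]
    simp only [Prod.fst_swap, Prod.snd_swap]
    congr 3
    push_cast
    ring
  · rw [boundedStanley, mul_sum]
    refine sum_congr rfl fun i hi => ?_
    rw [HasAntidiagonal.mem_antidiagonal] at hi
    rw [neg_sq, ← mul_div_assoc]
    congr 1
    -- The factor `x^a` contributes `q^(2a)` and the sign `(-1)^a`; by `neg_one_pow_tri` the sign
    -- splits into the prefactor and the sign of `(-q)^tri(a - b)`.
    have h2 : 2 * i.1 + tri ((i.1 : ℤ) - (i.2 + 1 : ℕ)) = (s + 1) + tri ((i.1 : ℤ) - i.2) := by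
      have h := tri_add_one ((i.1 : ℤ) - (i.2 + 1 : ℕ))
      have e : (i.1 : ℤ) - (i.2 + 1 : ℕ) + 1 = i.1 - i.2 := by push_cast; ring
      rw [e] at h
      push_cast at h ⊢
      omega
    rw [neg_pow (q ^ 2), neg_pow q, ← pow_mul, mul_assoc, ← pow_add, h2, pow_add,
      ← neg_one_pow_tri i.1 i.2, hi]
    ring

/-- The induction lets `q` vary because odd multiplicities of `s + 1` use the hypothesis at `-q`. -/
theorem hasSum_boundedStanley {q : ℂ} (hq : ‖q‖ < 1) (s : ℕ) :
    HasSum (fun μ : boundedParts s => stanleyWeight μ * q ^ μ.1.sum) (boundedStanley q s) := by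
  induction s generalizing q with
  | zero =>
    have h := hasSum_boundedParts_zero fun μ => stanleyWeight μ * q ^ μ.sum
    have e : boundedStanley q 0 = stanleyWeight 0 * q ^ (0 : Multiset ℕ).sum := by
      simp [boundedStanley, stanleyWeight, columnFactor, finPoch, tri]
    rwa [e]
  | succ s ih =>
    have hx := norm_neg_sq_lt_one hq
    have hqn : ‖-q‖ < 1 := by rwa [norm_neg]
    set X := -q ^ 2 * (-q ^ 2) ^ s with hX
    have hX1 : ‖X‖ < 1 := by
      rw [hX, ← pow_succ', norm_pow]
      exact pow_lt_one₀ (norm_nonneg _) hx (Nat.succ_ne_zero s)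
    set w := (-1 : ℂ) ^ ((s + 1) / 2) * q ^ (s + 1) with hw
    have hne : 1 - X ≠ 0 := one_sub_mul_pow_ne_zero hx s
    have hgeo := hasSum_geometric_of_norm_lt_one hX1
    have hmul : ∀ {f : ℕ → ℂ} {a : ℂ} {p : ℂ}, ‖p‖ < 1 → HasSum f a →
        HasSum (fun i : ℕ × boundedParts s => f i.1 * (stanleyWeight i.2 * p ^ i.2.1.sum))
          (a * boundedStanley p s) := by
      intro f a p hp hf
      exact hasSum_mul_of_hasSum (f := f)
        (g := fun μ : boundedParts s => stanleyWeight μ * p ^ μ.1.sum) hf (ih hp)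
    have he : ∀ k : ℕ, 2 * k / 2 = k := fun k => by omega
    have ho : ∀ k : ℕ, (2 * k + 1) / 2 = k := fun k => by omega
    have ho' : ∀ k : ℕ, ¬ Even (2 * k + 1) := fun k =>
      Nat.not_even_iff_odd.mpr (odd_two_mul_add_one k)
    -- The series over the multiplicity `k` of `s + 1` is split by parity: `k = 2j` carries `X^j`
    -- and pairs with `q`, `k = 2j + 1` carries `w X^j` and pairs with `-q`.
    have hA : HasSum (fun k : ℕ => if Even k then X ^ (k / 2) else 0) ((1 - X)⁻¹ + 0) := by
      refine HasSum.even_add_odd ?_ ?_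
      · simpa only [if_pos (even_two_mul _), he] using hgeo
      · simpa only [if_neg (ho' _)] using hasSum_zero
    have hB : HasSum (fun k : ℕ => if Even k then 0 else w * X ^ (k / 2))
        (0 + w * (1 - X)⁻¹) := by
      refine HasSum.even_add_odd ?_ ?_
      · simpa only [if_pos (even_two_mul _)] using hasSum_zero
      · simpa only [if_neg (ho' _), ho] using hgeo.mul_left w
    rw [add_zero] at hA
    rw [zero_add] at hB
    rw [← (adjoinParts s).hasSum_iff]
    have e : boundedStanley q (s + 1) =
        (1 - X)⁻¹ * boundedStanley q s + w * (1 - X)⁻¹ * boundedStanley (-q) s := by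
      have h := boundedStanley_succ hq s
      rw [← hX, ← hw] at h
      field_simp
      rw [mul_comm, h]
    rw [e]
    refine ((hmul hq hA).add (hmul hqn hB)).congr_fun ?_
    rintro ⟨k, μ⟩
    obtain ⟨j, rfl | rfl⟩ := k.even_or_odd'
    · rw [Function.comp_apply, stanleyWeight_adjoin_even, if_pos (even_two_mul j),
        if_pos (even_two_mul j), Nat.mul_div_cancel_left j two_pos, zero_mul, add_zero]
    · have ho : ¬ Even (2 * j + 1) := Nat.not_even_iff_odd.mpr (odd_two_mul_add_one j)
      rw [Function.comp_apply, stanleyWeight_adjoin_odd, if_neg ho, if_neg ho,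
        show (2 * j + 1) / 2 = j by omega, zero_mul, zero_add]

/-! ### Identities between infinite products. -/

theorem norm_pow_lt_one {q : ℂ} (hq : ‖q‖ < 1) {n : ℕ} (hn : n ≠ 0) : ‖q ^ n‖ < 1 := by
  rw [norm_pow]
  exact pow_lt_one₀ (norm_nonneg q) hq hn

theorem qPoch_eq_one_sub_mul (a : ℂ) {q : ℂ} (hq : ‖q‖ < 1) :
    qPoch a q = (1 - a) * qPoch (a * q) q := by
  refine tendsto_nhds_unique ((tendsto_add_atTop_iff_nat 1).mpr (tendsto_finPoch a hq))
    (((tendsto_finPoch (a * q) hq).const_mul (1 - a)).congr fun n => ?_)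
  rw [finPoch, finPoch, prod_range_succ', mul_comm]
  congr 1
  · exact prod_congr rfl fun k _ => by ring
  · ring

theorem qPoch_dissection (a : ℂ) {q : ℂ} (hq : ‖q‖ < 1) :
    qPoch a q = qPoch a (q ^ 2) * qPoch (a * q) (q ^ 2) := by
  have hq2 := norm_pow_lt_one hq two_ne_zero
  have h2 : Tendsto (fun n : ℕ => 2 * n) atTop atTop :=
    tendsto_atTop_mono (fun n => Nat.le_mul_of_pos_left n two_pos) tendsto_id
  refine tendsto_nhds_unique ((tendsto_finPoch a hq).comp h2)
    (((tendsto_finPoch a hq2).mul (tendsto_finPoch (a * q) hq2)).congr fun n => ?_)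
  rw [Function.comp_apply]
  induction n with
  | zero => simp [finPoch]
  | succ n ih =>
    rw [mul_add, mul_one, finPoch_succ, finPoch_succ, finPoch_succ, finPoch_succ, ← ih]
    ring

theorem qPoch_mul_qPoch_neg (a : ℂ) {q : ℂ} (hq : ‖q‖ < 1) :
    qPoch a q * qPoch (-a) q = qPoch (a ^ 2) (q ^ 2) := by
  refine tendsto_nhds_unique ((tendsto_finPoch a hq).mul (tendsto_finPoch (-a) hq))
    ((tendsto_finPoch (a ^ 2) (norm_pow_lt_one hq two_ne_zero)).congr fun n => ?_)
  rw [finPoch, finPoch, finPoch, ← prod_mul_distrib]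
  exact prod_congr rfl fun k _ => by ring

theorem qPoch_self_sq_mul {q : ℂ} (hq : ‖q‖ < 1) :
    qPoch q (q ^ 2) * qPoch (q ^ 2) (q ^ 2) = qPoch q q := by
  rw [qPoch_dissection q hq, ← sq]

/-- Expresses `(-q;q²)` through factors of the form `(q^k;q^k)`, the only ones in the final product.
-/
theorem qPoch_neg_self_sq_mul {q : ℂ} (hq : ‖q‖ < 1) :
    qPoch (-q) (q ^ 2) * qPoch q q * qPoch (q ^ 4) (q ^ 4) = qPoch (q ^ 2) (q ^ 2) ^ 2 := by
  have hq2 := norm_pow_lt_one hq two_ne_zero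
  have h1 := qPoch_self_sq_mul hq
  have h2 := qPoch_self_sq_mul hq2
  have h3 := qPoch_mul_qPoch_neg q hq2
  have e : (q ^ 2) ^ 2 = q ^ 4 := by ring
  rw [e] at h2 h3
  rw [← h1]
  linear_combination (qPoch (q ^ 2) (q ^ 2)) * (qPoch (q ^ 4) (q ^ 4) * h3 + h2)

/-- The identity `φ(Q) - φ(-Q) = 4 Q ψ(Q ^ 8)` between theta functions, in product form. -/
theorem theta_difference {Q : ℂ} (hQ0 : Q ≠ 0) (hQ : ‖Q‖ < 1) :
    qPoch (-Q) (Q ^ 2) ^ 2 * qPoch (Q ^ 2) (Q ^ 2) - qPoch Q (Q ^ 2) ^ 2 * qPoch (Q ^ 2) (Q ^ 2) =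
      4 * Q * qPoch (-Q ^ 8) (Q ^ 8) ^ 2 * qPoch (Q ^ 8) (Q ^ 8) := by
  have hQ2 := norm_pow_lt_one hQ two_ne_zero
  have hQ8 := norm_pow_lt_one hQ (n := 8) (by norm_num)
  have h1 := jacobi_triple_product (pow_ne_zero 2 hQ0) hQ2 hQ0
  have h2 := jacobi_triple_product (pow_ne_zero 2 hQ0) hQ2 (neg_ne_zero.mpr hQ0)
  have h3 := (jacobi_triple_product (pow_ne_zero 8 hQ0) hQ8 one_ne_zero).mul_left (2 * Q)
  have h4 := h1.sub h2
  -- The two theta series have terms `(±1)^c Q^(c²)`. Even `c` cancel, and `c = 2m - 1` has `c² = 8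
  -- tri(m) + 1`.
  have hinj : Function.Injective fun m : ℤ => 2 * m - 1 := fun a b h => by
    simp only at h
    omega
  rw [← hinj.hasSum_iff] at h4
  · have h5 : ∀ m : ℤ, 2 * Q * (1 ^ m * (Q ^ 8) ^ tri m) =
        Q ^ (2 * m - 1) * (Q ^ 2) ^ tri (2 * m - 1) -
          (-Q) ^ (2 * m - 1) * (Q ^ 2) ^ tri (2 * m - 1) := by
      intro m
      have ho : Odd (2 * m - 1) := ⟨m - 1, by ring⟩
      have e : Q ^ (2 * m - 1) * (Q ^ 2) ^ tri (2 * m - 1) = Q * (Q ^ 8) ^ tri m := by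
        rw [← pow_mul, ← pow_mul, ← pow_succ', ← zpow_natCast, ← zpow_natCast, ← zpow_add₀ hQ0]
        congr 1
        have t1 := two_mul_tri (2 * m - 1)
        have t2 := two_mul_tri m
        push_cast
        linear_combination t1 - 4 * t2
      rw [ho.neg_zpow, e, neg_mul, e, one_zpow]
      ring
    have h6 := (h3.congr_fun fun m => (h5 m).symm).unique h4
    have e1 : -(Q ^ 2 / Q) = -Q := by field_simp
    have e2 : -(Q ^ 2 / -Q) = Q := by field_simp
    -- `(-1;Q⁸) = 2 (-Q⁸;Q⁸)`, which together with the factor `2 Q` yields `4 Q`.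
    rw [e1, e2, neg_neg, div_one, qPoch_eq_one_sub_mul (-1) hQ8, neg_one_mul] at h6
    linear_combination -h6
  · intro c hc
    have he : Even c := by
      by_contra ho
      obtain ⟨k, hk⟩ := Int.not_even_iff_odd.mp ho
      exact hc ⟨k + 1, by simp only; omega⟩
    rw [he.neg_zpow, sub_self]

theorem tendsto_boundedStanley {q : ℂ} (hq0 : q ≠ 0) (hq : ‖q‖ < 1) :
    Tendsto (fun N => boundedStanley q (2 * N)) atTop
      (𝓝 (qPoch (-q) (q ^ 2) * qPoch (q ^ 4) (q ^ 4) / qPoch (-q ^ 2) (-q ^ 2) ^ 2)) := by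
  have hq4 := norm_pow_lt_one hq four_ne_zero
  have hsum := summable_theta (pow_ne_zero 4 hq0) hq4 hq0
  have h := tendsto_sum_div_finPoch (norm_neg_sq_lt_one hq) hsum
  have e : q ^ 4 = (q ^ 2) ^ 2 := by ring
  have e2 : -(q ^ 4 / q) = -q * q ^ 2 := by field_simp
  rw [(jacobi_triple_product (pow_ne_zero 4 hq0) hq4 hq0).tsum_eq, e2] at h
  have h2 := qPoch_dissection (-q) (norm_pow_lt_one hq two_ne_zero)
  rw [← e] at h2
  rw [h2]
  refine h.congr fun N => ?_
  rw [boundedStanley, sum_antidiagonal_two_mul N fun a b => q ^ tri ((a : ℤ) - b) /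
    (finPoch (-q ^ 2) (-q ^ 2) a * finPoch (-q ^ 2) (-q ^ 2) b)]
  refine sum_congr rfl fun c hc => ?_
  rw [mem_Icc] at hc
  congr 1
  -- Here `a - b = 2c` and `tri (2c) = c + 4 tri c`, whence the theta function with base `q⁴`.
  have e3 : (((N + c).toNat : ℤ) - (N - c).toNat) = 2 * c := by omega
  rw [e3, ← pow_mul, ← zpow_natCast, ← zpow_natCast, ← zpow_add₀ hq0]
  congr 1
  have t1 := two_mul_tri (2 * c)
  have t2 := two_mul_tri c
  push_cast
  linarith

theorem stanley_product_identity {q : ℂ} (hq0 : q ≠ 0) (hq : ‖q‖ < 1) :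
    (qPoch q q)⁻¹ - qPoch (-q) (q ^ 2) * qPoch (q ^ 4) (q ^ 4) / qPoch (-q ^ 2) (-q ^ 2) ^ 2 =
      2 * (2 * q ^ 2 * qPoch (q ^ 2) (q ^ 2) ^ 2 * qPoch (q ^ 8) (q ^ 8) ^ 2
          * qPoch (q ^ 32) (q ^ 32) ^ 2
        / (qPoch q q * qPoch (q ^ 4) (q ^ 4) ^ 5 * qPoch (q ^ 16) (q ^ 16))) := by
  have n {k : ℕ} (hk : k ≠ 0) := norm_pow_lt_one hq hk
  have h1 : qPoch q q ≠ 0 := qPoch_self_ne_zero hq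
  have h2 : qPoch (q ^ 2) (q ^ 2) ≠ 0 := qPoch_self_ne_zero (n (by norm_num))
  have h4 : qPoch (q ^ 4) (q ^ 4) ≠ 0 := qPoch_self_ne_zero (n (by norm_num))
  have h8 : qPoch (q ^ 8) (q ^ 8) ≠ 0 := qPoch_self_ne_zero (n (by norm_num))
  have h16 : qPoch (q ^ 16) (q ^ 16) ≠ 0 := qPoch_self_ne_zero (n (by norm_num))
  have a1 := qPoch_neg_self_sq_mul hq
  have a2 := qPoch_neg_self_sq_mul (n two_ne_zero)
  have a3 := qPoch_self_sq_mul (n two_ne_zero)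
  have a4 := theta_difference (pow_ne_zero 2 hq0) (n two_ne_zero)
  have a5 := qPoch_mul_qPoch_neg (q ^ 16) (n (k := 16) (by norm_num))
  have a6 := qPoch_dissection (-q ^ 2) (norm_neg_sq_lt_one hq)
  simp only [neg_sq, neg_mul_neg, ← pow_add, ← pow_mul, Nat.reduceMul, Nat.reduceAdd] at a2 a3 a4 a5 a6
  -- Once every product is expressed through the `(q^k;q^k)`, the claim is `a4`, the theta
  -- difference at `Q = q²`, with denominators cleared.
  rw [← eq_div_iff h4, ← eq_div_iff h1] at a1
  rw [← eq_div_iff h8, ← eq_div_iff h2] at a2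
  rw [← eq_div_iff h4] at a3
  rw [mul_comm, ← eq_div_iff h16] at a5
  rw [a6, a1, a2]
  rw [a2, a3, a5] at a4
  field_simp at a4 ⊢
  linear_combination a4

/-! ### From the weight back to the congruence modulo 4. -/

theorem columnFactor_eq_pow (ζ : ℂ) (μ : Multiset ℕ) (N : ℕ) :
    columnFactor ζ μ N =
      ζ ^ #{i ∈ range N | Odd (μ.countP fun a => i + 1 ≤ a)} := by
  rw [columnFactor, prod_ite, prod_const, prod_const_one, mul_one]

theorem oddParts_conj {n : ℕ} (l : Nat.Partition n) :
    oddParts (conj l) = #{i ∈ range n | Odd (l.parts.countP fun a => i + 1 ≤ a)} := by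
  have h : oddParts (conj l) = (conjParts l).countP Odd := by
    -- The zeros discarded in forming the conjugate are even, so the count does not change.
    change ((conjParts l).filter (· ≠ 0)).countP Odd = _
    rw [Multiset.countP_filter]
    refine Multiset.countP_congr rfl fun a _ => ?_
    simp only [ne_eq, eq_iff_iff, and_iff_left_iff_imp]
    exact fun h => h.pos.ne'
  rw [h, conjParts, Multiset.countP_map]
  rfl

theorem neg_one_pow_countP_odd (μ : Multiset ℕ) : (-1 : ℂ) ^ μ.countP Odd = (-1) ^ μ.sum := by
  induction μ using Multiset.induction_on with
  | empty => rfl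
  | cons a μ ih =>
    rw [Multiset.countP_cons, Multiset.sum_cons, pow_add, pow_add, ih, mul_comm]
    congr 1
    split_ifs with h
    · rw [h.neg_one_pow, pow_one]
    · rw [(Nat.not_odd_iff_even.mp h).neg_one_pow, pow_zero]

/-- As `-I = I^3`, the exponent of `I` is `O(λ') + 3 O(λ)`; equal parities leave only the residues
`0` and `2` modulo `4`. -/
theorem stanleyWeight_parts {n : ℕ} (l : Nat.Partition n) :
    stanleyWeight l.parts = if oddParts l ≡ oddParts (conj l) [MOD 4] then 1 else -1 := by
  have hle : ∀ a ∈ l.parts, a ≤ n := fun _ ha => Nat.Partition.le_of_mem_parts ha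
  have h1 : (-1 : ℂ) ^ oddParts (conj l) = (-1) ^ oddParts l := by
    rw [oddParts_conj, ← columnFactor_eq_pow, columnFactor_neg_one hle, oddParts,
      neg_one_pow_countP_odd]
  have h2 : Even (oddParts (conj l)) ↔ Even (oddParts l) := by
    rw [← neg_one_pow_eq_one_iff_even (R := ℂ) (by norm_num), h1,
      neg_one_pow_eq_one_iff_even (by norm_num)]
  have h3 : stanleyWeight l.parts = Complex.I ^ (oddParts (conj l) + 3 * oddParts l) := by
    rw [stanleyWeight, columnFactor_eq _ hle, columnFactor_eq_pow, ← oddParts_conj, pow_add,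
      pow_mul, Complex.I_pow_three, ← oddParts]
  rw [Nat.even_iff, Nat.even_iff] at h2
  rw [h3, Complex.I_pow_eq_pow_mod]
  split_ifs with h <;> rw [Nat.ModEq] at h
  · rw [show (oddParts (conj l) + 3 * oddParts l) % 4 = 0 by omega, pow_zero]
  · rw [show (oddParts (conj l) + 3 * oddParts l) % 4 = 2 by omega, Complex.I_sq]

theorem u_eq (n : ℕ) : (u n : ℂ) =
    ((∑ _l : Nat.Partition n, (1 : ℂ)) - ∑ l : Nat.Partition n, stanleyWeight l.parts) / 2 := by
  have h := card_filter_add_card_filter_not (s := (univ : Finset (Nat.Partition n)))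
    fun l => oddParts l ≡ oddParts (conj l) [MOD 4]
  simp only [stanleyWeight_parts, sum_ite, sum_const, nsmul_eq_mul, mul_one, ← h, u, p, t,
    ← card_univ]
  push_cast
  ring

end StanleyPartition


theorem theorem1 (q : ℂ) (hq : ‖q‖ < 1) :
    HasSum (fun n : ℕ => (StanleyPartition.u n : ℂ) * q ^ n)
      (2 * q ^ 2 * StanleyPartition.qPoch (q ^ 2) (q ^ 2) ^ 2
          * StanleyPartition.qPoch (q ^ 8) (q ^ 8) ^ 2
          * StanleyPartition.qPoch (q ^ 32) (q ^ 32) ^ 2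
        / (StanleyPartition.qPoch q q * StanleyPartition.qPoch (q ^ 4) (q ^ 4) ^ 5
          * StanleyPartition.qPoch (q ^ 16) (q ^ 16))) := by
  open StanleyPartition in
  -- The triple product needs `q ≠ 0`; at `q = 0` only the term `u 0 = 0` matters.
  rcases eq_or_ne q 0 with rfl | hq0
  · have h0 : u 0 = 0 := by
      have h := u_eq 0
      simpa [stanleyWeight, columnFactor] using h
    have h : HasSum (fun n : ℕ => (u n : ℂ) * 0 ^ n) ((u 0 : ℂ) * 0 ^ 0) :=
      hasSum_single 0 fun n hn => by rw [zero_pow hn, mul_zero]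
    simpa [h0] using h
  · have h1 := hasSum_partition_of_tendsto (w := fun _ => 1) (fun _ => norm_one.le) hq
      (fun s => by simpa only [one_mul] using (hasSum_pow_sum hq s).2) Filter.tendsto_id
      (tendsto_inv_finPoch_self hq)
    -- Even bounds `s = 2N` suffice, since the limit along all `s` exists by dominated convergence.
    have h2 := hasSum_partition_of_tendsto norm_stanleyWeight_le hq (hasSum_boundedStanley hq)
      (Filter.tendsto_atTop_mono (fun n => Nat.le_mul_of_pos_left n two_pos) Filter.tendsto_id)
      (tendsto_boundedStanley hq0 hq)
    have h3 := (h1.sub h2).div_const 2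
    rw [stanley_product_identity hq0 hq, mul_div_cancel_left₀ _ two_ne_zero] at h3
    refine h3.congr_fun fun n => ?_
    rw [u_eq]
    ring
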